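/- Let $T^3=\mathbb R^3/\mathbb Z^3$ and let $\mu\in L^1(\mathbb R^3)\cap L^2(\mathbb R^3)$ be real-valued with $\int_{\mathbb R^3}\mu\,dx=Z>0$ and $\mu_{\rm per}(x):=\sum_{n\in\mathbb Z^3}\mu(x-n)\in L^2(T^3)$. For $f\in L^2(T^3)$ put $G_{\rm per}f(x):=\sum_{m\in\mathbb Z^3\setminus 0}|2\pi m|^{-2}\hat f(m)e^{2\pi i m\cdot x}$, where $\hat f(m)=\int_{T^3}f(x)e^{-2\pi i m\cdot x}dx$. For $e>0$ take the ion charge density $\sigma=e\mu$. For $\psi\in H^1(T^3)$ let $$\rho:=\sigma_{\rm per}-e|\psi|^2=e(\mu_{\rm per}-|\psi|^2),\qquad U_e(\psi):=\tfrac12\int_{T^3}\big[|\nabla\psi|^2+\rho\,G_{\rm per}\rho\big]dx,\qquad \mathcal M:=\Big\{\psi\in H^1(T^3;\mathbb C):\int_{T^3}|\psi|^2dx=Z\Big\}.$$ A minimizing ground state for $e$ is a pair $(\psi^0_e,\omega^0_e)$ with $\omega^0_e\in\mathbb R$, such that $\psi^0_e$ minimizes $U_e$ on $\mathcal M$ and,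 with $\Phi^0_e:=eG_{\rm per}(\mu_{\rm per}-|\psi^0_e|^2)$, $$\omega^0_e\psi^0_e=-\tfrac12\Delta\psi^0_e-e\Phi^0_e\psi^0_e\quad\text{weakly on }T^3 .$$ Then there are $e_0>0$ and $C$, depending only on $\mu$, such that for every $e\in(0,e_0]$ and every minimizing ground state $(\psi^0_e,\omega^0_e)$ for $e$: 1. the operator $H^0_e:=-\tfrac12\Delta-e\Phi^0_e(x)-\omega^0_e$ in $L^2(T^3)$ is nonnegative, that is, $\tfrac12\int_{T^3}|\nabla u|^2dx-e\int_{T^3}\Phi^0_e|u|^2dx-\omega^0_e\int_{T^3}|u|^2dx\ge0$ for all $u\in H^1(T^3)$; 2. $|\omega^0_e|\le Ce^2$, that is, $\omega^0_e=\mathcal O(e^2)$ as $e\to0$; 3. $\psi^0_e=\gamma_e+\chi_e$ with a constant $\gamma_e\in\mathbb C$ and $\chi_e\in H^2(T^3)$ such that $\big||\gamma_e|^2-Z\big|\le Ce^4$ and $\|\chi_e\|_{H^2(T^3)}\le Ce^2$, that is, $|\gamma_e|^2=Z+\mathcal O(e^4)$ and $\|\chi_e\|_{H^2(T^3)}=\mathcal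 O(e^2)$ as $e\to0$. -/

import Mathlib

noncomputable section

namespace SchrodingerPoisson

open MeasureTheory

/-- The torus `T³ = ℝ³ / ℤ³`. -/
abbrev T3 : Type := UnitAddTorus (Fin 3)

/-- The Lebesgue measure on `T³`, of total mass `1`. -/
abbrev torusMeasure : Measure T3 :=
  Measure.pi fun _ : Fin 3 => (AddCircle.haarAddCircle : Measure UnitAddCircle)

/-- The representative in `[0,1)³` of a point of `T³`. -/
def cellRep (x : T3) : Fin 3 → ℝ :=
  fun i => (AddCircle.equivIco (1 : ℝ) 0 (x i) : ℝ)

/-- The periodization `∑ₙ f(x - n)`, `n ∈ ℤ³`, as a function on `T³`. -/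
def periodize (f : (Fin 3 → ℝ) → ℝ) (x : T3) : ℝ :=
  ∑' n : Fin 3 → ℤ, f (cellRep x - fun i => (n i : ℝ))

/-- `|2πm|²`, the eigenvalue of `-Δ` on the character `exp(2πi m·x)`. -/
def freqSq (m : Fin 3 → ℤ) : ℝ :=
  (2 * Real.pi) ^ 2 * ∑ i, (m i : ℝ) ^ 2

/-- Membership in the Sobolev space `Hˢ(T³)`. -/
def MemSobolev (s : ℕ) (u : T3 → ℂ) : Prop :=
  MemLp u 2 torusMeasure ∧
    Summable fun m : Fin 3 → ℤ => (1 + freqSq m) ^ s * ‖UnitAddTorus.mFourierCoeff u m‖ ^ 2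

/-- The norm of `Hˢ(T³)` (meaningful on functions satisfying `MemSobolev s`). -/
def sobolevNorm (s : ℕ) (u : T3 → ℂ) : ℝ :=
  Real.sqrt (∑' m : Fin 3 → ℤ, (1 + freqSq m) ^ s * ‖UnitAddTorus.mFourierCoeff u m‖ ^ 2)

/-- The Dirichlet form `∫ conj(∇u) · ∇v` over `T³`, for `u, v ∈ H¹(T³)`. -/
def dirichletForm (u v : T3 → ℂ) : ℂ :=
  ∑' m : Fin 3 → ℤ, (freqSq m : ℂ) *
    (starRingEnd ℂ (UnitAddTorus.mFourierCoeff u m) * UnitAddTorus.mFourierCoeff v m)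

/-- The operator `G_per`, the inverse of `-Δ` on `T³` with the zero mode removed:
`G_per f(x) = ∑_{m ≠ 0} |2πm|⁻² f̂(m) exp(2πi m·x)`. For real `f ∈ L²(T³)` the series converges
absolutely and its sum is real. -/
def perGreen (f : T3 → ℝ) (x : T3) : ℝ :=
  (∑' m : Fin 3 → ℤ, if m = 0 then 0 else
    UnitAddTorus.mFourierCoeff (fun y => (f y : ℂ)) m / (freqSq m : ℂ) *
      UnitAddTorus.mFourier m x).re

/-- The total charge density `ρ = σ_per - e|ψ|²` in a cell. -/
def chargeDensity (e : ℝ) (σ : (Fin 3 → ℝ) → ℝ) (ψ : T3 → ℂ) (x : T3) : ℝ :=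
  periodize σ x - e * ‖ψ x‖ ^ 2

/-- The electrostatic potential `Φ = G_per ρ`. -/
def potential (e : ℝ) (σ : (Fin 3 → ℝ) → ℝ) (ψ : T3 → ℂ) : T3 → ℝ :=
  perGreen (chargeDensity e σ ψ)

/-- The energy per cell `U(ψ) = ½ ∫ (|∇ψ|² + ρ G_per ρ)` over `T³`. -/
def cellEnergy (e : ℝ) (σ : (Fin 3 → ℝ) → ℝ) (ψ : T3 → ℂ) : ℝ :=
  1 / 2 * ((dirichletForm ψ ψ).re +
    ∫ x, chargeDensity e σ ψ x * perGreen (chargeDensity e σ ψ) x ∂torusMeasure)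

/-- The manifold `M` of all `ψ ∈ H¹(T³)` with `∫ |ψ|² = Z`. -/
def admissible (Z : ℝ) : Set (T3 → ℂ) :=
  {ψ | MemSobolev 1 ψ ∧ ∫ x, ‖ψ x‖ ^ 2 ∂torusMeasure = Z}

/-- The sesquilinear form `⟨u, H v⟩` on `H¹(T³)` of the Schrödinger operator
`H = -½ Δ - e Φ(x) - ω` in `L²(T³)`. -/
def schrodingerForm (e : ℝ) (Φ : T3 → ℝ) (ω : ℝ) (u v : T3 → ℂ) : ℂ :=
  1 / 2 * dirichletForm u v
    - (e : ℂ) * ∫ x, (Φ x : ℂ) * (starRingEnd ℂ (u x) * v x) ∂torusMeasure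
    - (ω : ℂ) * ∫ x, starRingEnd ℂ (u x) * v x ∂torusMeasure

/-- `(ψ, ω)` is a minimizing ground state for the elementary charge `e` and the ion density `σ`
with `∫ σ = eZ`: `ψ` minimizes the energy per cell on `M`, and the stationary equation
`ω ψ = -½ Δψ - e Φ ψ` with `Φ = G_per (σ_per - e|ψ|²)` holds in the weak sense. -/
structure IsGroundState (e : ℝ) (σ : (Fin 3 → ℝ) → ℝ) (Z : ℝ) (ψ : T3 → ℂ) (ω : ℝ) : Prop where
  mem : ψ ∈ admissible Z
  isMin : IsMinOn (cellEnergy e σ) (admissible Z) ψ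
  stationary : ∀ v : T3 → ℂ, MemSobolev 1 v →
    schrodingerForm e (potential e σ ψ) ω v ψ = 0

end SchrodingerPoisson

end

/-! With σ = eμ the charge density is e times a unit-charge density, so the energy is ½(‖∇ψ‖² +
e²K(ψ)) with K ≥ 0. Comparing a minimizer with the constant √Z, whose gradient vanishes, gives ‖∇ψ‖²
≤ e²K(√Z). For e ≤ 1 this bounds the H¹ norm of ψ in terms of μ alone.

The key analytic input is `greenWeight_mFourierCoeff_norm_sq`: in dimension three the series for
G_per|ψ|² converges absolutely, uniformly on H¹-bounded sets. Hence Φ = O(e) in the sup norm, and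
testing the stationary equation with ψ itself gives ω = O(e²).

Mode by mode the equation reads |2πm|² ψ̂(m) = 2((ω + eΦ)ψ)^(m), with right side O(e²) in ℓ². So the
oscillating part χ is O(e²) in H², and by Parseval the zero mode γ = ψ̂(0) satisfies Z − |γ|² = ‖χ‖²
= O(e⁴) (`memSobolev_two_of_stationary`).

Nonnegativity needs no positivity of the ground state. Since γ ≠ 0, every u equals cψ + w with w of
mean zero; as Hψ = 0, ⟨u,Hu⟩ = ⟨w,Hw⟩. On mean-zero functions the spectral gap of −½Δ beats the
O(e²) perturbation (`schrodingerForm_nonneg_of_stationary`). -/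

namespace SchrodingerPoisson

open MeasureTheory UnitAddTorus
open scoped ComplexConjugate

/-! ### Fourier coefficients of square integrable functions on the torus -/

theorem mFourierCoeff_eq (f : T3 → ℂ) (m : Fin 3 → ℤ) :
    mFourierCoeff f m = ∫ x, mFourier (-m) x * f x ∂torusMeasure := rfl

theorem mFourierCoeff_congr_ae {f g : T3 → ℂ} (h : f =ᵐ[torusMeasure] g) (m : Fin 3 → ℤ) :
    mFourierCoeff f m = mFourierCoeff g m := by
  rw [mFourierCoeff_eq, mFourierCoeff_eq]
  exact integral_congr_ae (h.mono fun x hx => by simp only [hx])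

theorem norm_mFourier_apply (m : Fin 3 → ℤ) (x : T3) : ‖mFourier m x‖ = 1 := by
  simp only [mFourier, fourier_apply, ContinuousMap.coe_mk, norm_prod, Circle.norm_coe,
    Finset.prod_const_one]

theorem memLp_mFourier (m : Fin 3 → ℤ) (p : ENNReal) : MemLp (mFourier m) p torusMeasure :=
  MemLp.of_bound (mFourier m).continuous.aestronglyMeasurable 1
    (.of_forall fun x => (norm_mFourier_apply m x).le)

theorem integrable_mFourier_mul {f : T3 → ℂ} (hf : Integrable f torusMeasure) (m : Fin 3 → ℤ) :
    Integrable (fun x => mFourier m x * f x) torusMeasure :=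
  hf.bdd_mul (mFourier m).continuous.aestronglyMeasurable
    (.of_forall fun x => (norm_mFourier_apply m x).le)

/-- Parseval's identity. -/
theorem hasSum_conj_mul_mFourierCoeff {f g : T3 → ℂ} (hf : MemLp f 2 torusMeasure)
    (hg : MemLp g 2 torusMeasure) :
    HasSum (fun m => conj (mFourierCoeff f m) * mFourierCoeff g m)
      (∫ x, conj (f x) * g x ∂torusMeasure) := by
  have h := hasSum_prod_mFourierCoeff (hf.toLp f) (hg.toLp g)
  have e1 : ∀ m, mFourierCoeff (hf.toLp f) m = mFourierCoeff f m :=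
    mFourierCoeff_congr_ae hf.coeFn_toLp
  have e2 : ∀ m, mFourierCoeff (hg.toLp g) m = mFourierCoeff g m :=
    mFourierCoeff_congr_ae hg.coeFn_toLp
  have e3 : ∫ x, conj (hf.toLp f x) * hg.toLp g x ∂torusMeasure
      = ∫ x, conj (f x) * g x ∂torusMeasure := by
    apply integral_congr_ae
    filter_upwards [hf.coeFn_toLp, hg.coeFn_toLp] with x h1 h2
    rw [h1, h2]
  rw [← e3]
  simp only [← e1, ← e2]
  exact h

theorem hasSum_norm_sq_mFourierCoeff {f : T3 → ℂ} (hf : MemLp f 2 torusMeasure) :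
    HasSum (fun m => ‖mFourierCoeff f m‖ ^ 2) (∫ x, ‖f x‖ ^ 2 ∂torusMeasure) := by
  have h := hasSum_conj_mul_mFourierCoeff hf hf
  simp only [Complex.conj_mul', ← Complex.ofReal_pow] at h
  rw [integral_complex_ofReal] at h
  exact Complex.hasSum_ofReal.1 h

theorem integrable_norm_sq {f : T3 → ℂ} (hf : MemLp f 2 torusMeasure) :
    Integrable (fun x => ‖f x‖ ^ 2) torusMeasure := hf.integrable_norm_pow two_ne_zero

theorem integrable_conj_mul {f g : T3 → ℂ} (hf : MemLp f 2 torusMeasure)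
    (hg : MemLp g 2 torusMeasure) : Integrable (fun x => conj (f x) * g x) torusMeasure :=
  hf.star.integrable_mul hg

theorem mFourierCoeff_mFourier (n m : Fin 3 → ℤ) :
    mFourierCoeff (mFourier n : T3 → ℂ) m = if m = n then 1 else 0 := by
  have h : mFourierCoeff (mFourier n : T3 → ℂ) m
      = inner ℂ (mFourierLp (d := Fin 3) 2 m) (mFourierLp 2 n) := by
    rw [ContinuousMap.inner_toLp, mFourierCoeff_eq]
    refine integral_congr_ae (.of_forall fun x => ?_)
    simp only [mFourier_neg, mul_comm]
  rw [h, orthonormal_iff_ite.1 orthonormal_mFourier]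

theorem mFourierCoeff_mFourier_mul (f : T3 → ℂ) (n m : Fin 3 → ℤ) :
    mFourierCoeff (fun x => mFourier n x * f x) m = mFourierCoeff f (m - n) := by
  simp only [mFourierCoeff_eq]
  refine integral_congr_ae (.of_forall fun x => ?_)
  simp only [← mul_assoc, ← mFourier_add]
  congr 3
  abel

theorem mFourierCoeff_add_const_mul {f g : T3 → ℂ} (hf : Integrable f torusMeasure)
    (hg : Integrable g torusMeasure) (c : ℂ) (m : Fin 3 → ℤ) :
    mFourierCoeff (fun x => f x + c * g x) m = mFourierCoeff f m + c * mFourierCoeff g m := by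
  simp only [mFourierCoeff_eq]
  rw [← integral_const_mul, ← integral_add (integrable_mFourier_mul hf _)
    ((integrable_mFourier_mul hg _).const_mul c)]
  refine integral_congr_ae (.of_forall fun x => ?_)
  ring

theorem mFourierCoeff_const (c : ℂ) (m : Fin 3 → ℤ) :
    mFourierCoeff (fun _ : T3 => c) m = if m = 0 then c else 0 := by
  have h := mFourierCoeff_mFourier 0 m
  rw [mFourierCoeff_eq] at h ⊢
  rw [integral_mul_const]
  simp only [mFourier_zero, ContinuousMap.one_apply, mul_one] at h
  rw [h]
  simp

/-! ### The weights `1 + |2πm|²` -/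

theorem freqSq_nonneg (m : Fin 3 → ℤ) : 0 ≤ freqSq m := by
  unfold freqSq; positivity

theorem one_add_freqSq_pos (m : Fin 3 → ℤ) : 0 < 1 + freqSq m := by
  linarith [freqSq_nonneg m]

theorem freqSq_zero : freqSq 0 = 0 := by simp [freqSq]

theorem sum_sq_le_freqSq (m : Fin 3 → ℤ) : ∑ i, (m i : ℝ) ^ 2 ≤ freqSq m := by
  unfold freqSq
  refine le_mul_of_one_le_left (by positivity) ?_
  nlinarith [Real.pi_gt_three]

/-- A crude form of the spectral gap, whose true value is 4π²; the value 1 keeps later constants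
simple. -/
theorem one_le_freqSq {m : Fin 3 → ℤ} (hm : m ≠ 0) : 1 ≤ freqSq m := by
  refine le_trans ?_ (sum_sq_le_freqSq m)
  obtain ⟨i, hi⟩ := Function.ne_iff.1 hm
  refine le_trans ?_ (Finset.single_le_sum (fun j _ => sq_nonneg (m j : ℝ)) (Finset.mem_univ i))
  have : 1 ≤ (m i) ^ 2 := by
    have := Int.one_le_abs hi
    rw [← sq_abs]
    nlinarith
  exact_mod_cast this

/-- The norm here is the sup norm of `Fin 3 → ℝ`, the one used in the lattice sum below. -/
theorem norm_sq_le_freqSq (m : Fin 3 → ℤ) : ‖(fun i => (m i : ℝ) : Fin 3 → ℝ)‖ ^ 2 ≤ freqSq m := by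
  refine le_trans ?_ (sum_sq_le_freqSq m)
  have h : ‖(fun i => (m i : ℝ) : Fin 3 → ℝ)‖ ≤ Real.sqrt (∑ i, (m i : ℝ) ^ 2) := by
    refine (pi_norm_le_iff_of_nonneg (Real.sqrt_nonneg _)).2 fun i => ?_
    refine Real.le_sqrt_of_sq_le ?_
    rw [Real.norm_eq_abs, sq_abs]
    exact Finset.single_le_sum (fun j _ => sq_nonneg (m j : ℝ)) (Finset.mem_univ i)
  calc _ ≤ (Real.sqrt (∑ i, (m i : ℝ) ^ 2)) ^ 2 := by gcongr
    _ = _ := Real.sq_sqrt (by positivity)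

/-! ### Summability of the inverse squared weights over ℤ³ -/

theorem finrank_span_range_basisFun_lt_four :
    Module.finrank ℤ (Submodule.span ℤ (Set.range (Pi.basisFun ℝ (Fin 3)))) < 4 := by
  rw [Module.finrank_eq_card_basis ((Pi.basisFun ℝ (Fin 3)).restrictScalars ℤ)]
  simp

theorem intCast_mem_span_range_basisFun : ∀ m : Fin 3 → ℤ, (fun i => (m i : ℝ) : Fin 3 → ℝ) ∈
      Submodule.span ℤ (Set.range (Pi.basisFun ℝ (Fin 3))) := fun m => by
  rw [(Pi.basisFun ℝ (Fin 3)).mem_span_iff_repr_mem ℤ]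
  intro i
  exact ⟨m i, by simp⟩

theorem summable_inv_norm_pow_four_lattice :
    Summable fun z : Submodule.span ℤ (Set.range (Pi.basisFun ℝ (Fin 3))) =>
      ‖(z : Fin 3 → ℝ)‖⁻¹ ^ 4 :=
  ZLattice.summable_norm_pow_inv _ 4 finrank_span_range_basisFun_lt_four

theorem intCast_span_injective : Function.Injective fun m : Fin 3 → ℤ =>
    (⟨fun i => (m i : ℝ), intCast_mem_span_range_basisFun m⟩ :
      Submodule.span ℤ (Set.range (Pi.basisFun ℝ (Fin 3)))) := by
  intro m n hmn
  have h1 := Subtype.ext_iff.1 hmn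
  funext i
  exact Int.cast_injective (congrFun h1 i)

theorem summable_inv_norm_pow_four :
    Summable fun m : Fin 3 → ℤ => ‖(fun i => (m i : ℝ) : Fin 3 → ℝ)‖⁻¹ ^ 4 := by
  have := summable_inv_norm_pow_four_lattice.comp_injective intCast_span_injective
  simpa only [Function.comp_def] using this

/-- This is where dimension three enters: the terms decay like |m|⁻⁴, and 4 > 3. At m = 0 the
comparison series has the default value 0⁻¹ = 0, so a separate unit mass covers that term. -/
theorem summable_inv_one_add_freqSq_sq :
    Summable fun m : Fin 3 → ℤ => ((1 + freqSq m)⁻¹) ^ 2 := by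
  refine Summable.of_nonneg_of_le (fun m => by positivity) (fun m => ?_)
    (summable_inv_norm_pow_four.add (hasSum_ite_eq (0 : Fin 3 → ℤ) (1 : ℝ)).summable)
  by_cases hm : m = 0
  · simp [hm, freqSq_zero]
  · have h := norm_sq_le_freqSq m
    have h0 : 0 < ‖(fun i => (m i : ℝ) : Fin 3 → ℝ)‖ := by
      refine norm_pos_iff.2 fun h => hm ?_
      funext i
      have := congrFun h i
      simpa using this
    simp only [hm, if_false, add_zero]
    calc ((1 + freqSq m)⁻¹) ^ 2 ≤ ((‖(fun i => (m i : ℝ) : Fin 3 → ℝ)‖ ^ 2)⁻¹) ^ 2 := by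
          have h1 := one_add_freqSq_pos m
          gcongr
          linarith
      _ = _ := by rw [← inv_pow, ← pow_mul]

/-! ### The Green operator -/

/-- The Fourier multiplier of `perGreen`. -/
noncomputable def greenWeight (m : Fin 3 → ℤ) : ℝ := if m = 0 then 0 else (freqSq m)⁻¹

theorem greenWeight_nonneg (m : Fin 3 → ℤ) : 0 ≤ greenWeight m := by
  unfold greenWeight
  split_ifs
  · exact le_rfl
  · exact inv_nonneg.2 (freqSq_nonneg m)

theorem summable_greenWeight_sq : Summable fun m => greenWeight m ^ 2 := by
  refine Summable.of_nonneg_of_le (fun m => sq_nonneg _) (fun m => ?_)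
    (summable_inv_one_add_freqSq_sq.mul_left 4)
  have h1 := one_add_freqSq_pos m
  have h : greenWeight m ≤ 2 * (1 + freqSq m)⁻¹ := by
    unfold greenWeight
    split_ifs with hm
    · positivity
    · have := one_le_freqSq hm
      rw [← div_eq_mul_inv, le_div_iff₀ h1, inv_mul_le_iff₀ (by linarith)]
      linarith
  calc greenWeight m ^ 2 ≤ (2 * (1 + freqSq m)⁻¹) ^ 2 :=
        pow_le_pow_left₀ (greenWeight_nonneg m) h 2
    _ = _ := by ring

theorem perGreen_eq (f : T3 → ℝ) (x : T3) :
    perGreen f x = (∑' m, (greenWeight m * mFourierCoeff (fun y => (f y : ℂ)) m) *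
      mFourier m x).re := by
  unfold perGreen greenWeight
  congr 2
  funext m
  split_ifs with hm
  · simp
  · push_cast
    ring

theorem perGreen_const_mul (c : ℝ) (f : T3 → ℝ) :
    perGreen (fun x => c * f x) = fun x => c * perGreen f x := by
  funext x
  have h : ∀ m, mFourierCoeff (fun y => ((c * f y : ℝ) : ℂ)) m
      = c * mFourierCoeff (fun y => (f y : ℂ)) m := fun m => by
    rw [mFourierCoeff_eq, mFourierCoeff_eq, ← integral_const_mul]
    refine integral_congr_ae (.of_forall fun y => ?_)
    push_cast
    ring
  rw [perGreen_eq, perGreen_eq, ← Complex.re_ofReal_mul, ← tsum_mul_left]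
  simp only [h]
  congr 2
  funext m
  ring

section Potential

variable {f : T3 → ℝ}

theorem norm_green_term (f : T3 → ℝ) (m : Fin 3 → ℤ) (x : T3) :
    ‖(greenWeight m * mFourierCoeff (fun y => (f y : ℂ)) m) * mFourier m x‖
      = greenWeight m * ‖mFourierCoeff (fun y => (f y : ℂ)) m‖ := by
  rw [norm_mul, norm_mul, norm_mFourier_apply, mul_one, Complex.norm_real,
    Real.norm_of_nonneg (greenWeight_nonneg m)]

theorem abs_perGreen_le
    (hf : Summable fun m => greenWeight m * ‖mFourierCoeff (fun y => (f y : ℂ)) m‖) (x : T3) :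
    |perGreen f x| ≤ ∑' m, greenWeight m * ‖mFourierCoeff (fun y => (f y : ℂ)) m‖ := by
  rw [perGreen_eq]
  exact (Complex.abs_re_le_norm _).trans
    (tsum_of_norm_bounded hf.hasSum fun m => (norm_green_term f m x).le)

theorem continuous_perGreen
    (hf : Summable fun m => greenWeight m * ‖mFourierCoeff (fun y => (f y : ℂ)) m‖) :
    Continuous (perGreen f) := by
  have h : perGreen f = fun x => (∑' m, (greenWeight m * mFourierCoeff (fun y => (f y : ℂ)) m) *
      mFourier m x).re := funext (perGreen_eq f)
  rw [h]
  exact Complex.continuous_re.comp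
    (continuous_tsum (fun m => continuous_const.mul (mFourier m).continuous) hf
      fun m x => (norm_green_term f m x).le)

/-- On the Fourier side the integral is ∑ `greenWeight m` |f̂(m)|². Since f is only assumed
integrable, L² Parseval is replaced by termwise integration, justified by absolute convergence of
the Green series. -/
theorem integral_mul_perGreen_nonneg (hint : Integrable f torusMeasure)
    (hf : Summable fun m => greenWeight m * ‖mFourierCoeff (fun y => (f y : ℂ)) m‖) :
    0 ≤ ∫ x, f x * perGreen f x ∂torusMeasure := by
  set F : (Fin 3 → ℤ) → T3 → ℂ := fun m x => (f x : ℂ) *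
    ((greenWeight m * mFourierCoeff (fun y => (f y : ℂ)) m) * mFourier m x) with hF
  have hintC : Integrable (fun x => (f x : ℂ)) torusMeasure := hint.ofReal
  have hFint : ∀ m, Integrable (F m) torusMeasure := fun m => by
    refine ((integrable_mFourier_mul hintC m).const_mul
      (greenWeight m * mFourierCoeff (fun y => (f y : ℂ)) m)).congr (.of_forall fun x => ?_)
    simp only [hF]
    ring
  have hFnorm : ∀ m, ∫ x, ‖F m x‖ ∂torusMeasure = (∫ x, ‖f x‖ ∂torusMeasure) *
      (greenWeight m * ‖mFourierCoeff (fun y => (f y : ℂ)) m‖) := fun m => by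
    rw [← integral_mul_const]
    refine integral_congr_ae (.of_forall fun x => ?_)
    simp only [hF]
    rw [norm_mul, norm_green_term, Complex.norm_real]
  have hsum := hasSum_integral_of_summable_integral_norm hFint
    (by simpa only [hFnorm] using hf.mul_left _)
  have hterm : ∀ m, ∫ x, F m x ∂torusMeasure
      = ((greenWeight m * ‖mFourierCoeff (fun y => (f y : ℂ)) m‖ ^ 2 : ℝ) : ℂ) := fun m => by
    have h1 : ∫ x, F m x ∂torusMeasure
        = (greenWeight m * mFourierCoeff (fun y => (f y : ℂ)) m) *
          ∫ x, mFourier m x * f x ∂torusMeasure := by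
      rw [← integral_const_mul]
      refine integral_congr_ae (.of_forall fun x => ?_)
      simp only [hF]
      ring
    -- Uses that f is real.
    have h2 : ∫ x, mFourier m x * f x ∂torusMeasure
        = conj (mFourierCoeff (fun y => (f y : ℂ)) m) := by
      rw [mFourierCoeff_eq, ← integral_conj]
      refine integral_congr_ae (.of_forall fun x => ?_)
      simp only [map_mul, mFourier_neg, Complex.conj_conj, Complex.conj_ofReal]
    rw [h1, h2, mul_assoc, Complex.mul_conj']
    push_cast
    ring
  have hre : ∫ x, f x * perGreen f x ∂torusMeasure = (∫ x, ∑' m, F m x ∂torusMeasure).re := by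
    have hi : Integrable (fun x => ∑' m, F m x) torusMeasure := by
      have hb : ∀ x, ∑' m, F m x = (∑' m, (greenWeight m * mFourierCoeff (fun y => (f y : ℂ)) m) *
          mFourier m x) * f x := fun x => by
        simp only [hF]
        rw [tsum_mul_left, mul_comm]
      simp only [hb]
      refine hintC.bdd_mul (c := ∑' m, greenWeight m * ‖mFourierCoeff (fun y => (f y : ℂ)) m‖)
        (Continuous.aestronglyMeasurable ?_) (.of_forall fun x => ?_)
      · exact continuous_tsum (fun m => continuous_const.mul (mFourier m).continuous) hf
          fun m x => (norm_green_term f m x).le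
      · exact tsum_of_norm_bounded hf.hasSum fun m => (norm_green_term f m x).le
    rw [← RCLike.re_eq_complex_re, ← integral_re hi]
    refine integral_congr_ae (.of_forall fun x => ?_)
    simp only [hF, RCLike.re_eq_complex_re]
    rw [tsum_mul_left, Complex.re_ofReal_mul, perGreen_eq]
  rw [hre, ← hsum.tsum_eq]
  simp only [hterm]
  rw [← Complex.ofReal_tsum, Complex.ofReal_re]
  exact tsum_nonneg fun m => mul_nonneg (greenWeight_nonneg m) (sq_nonneg _)

end Potential

/-! ### The density of an `H¹` function -/

/-- Young's inequality, then A⁻¹B⁻¹ ≤ ½(A⁻² + B⁻²). With A and B the H¹ weights of two frequencies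
and w the Green weight of their difference, each term on the right becomes a product of two
single-frequency series after reindexing. -/
theorem mul_mul_le_of_pos {w p q A B : ℝ} (hA : 0 < A) (hB : 0 < B) :
    w * (p * q) ≤ 1 / 2 * ((A * p ^ 2) * (B * q ^ 2))
      + (1 / 4 * (w ^ 2 * A⁻¹ ^ 2) + 1 / 4 * (w ^ 2 * B⁻¹ ^ 2)) := by
  have h1 : 0 ≤ (A * B * (p * q) - w) ^ 2 * (A⁻¹ * B⁻¹) := by positivity
  have h2 : (A * B * (p * q) - w) ^ 2 * (A⁻¹ * B⁻¹)
      = A * B * (p * q) ^ 2 - 2 * w * (p * q) + w ^ 2 * (A⁻¹ * B⁻¹) := by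
    field_simp
    ring
  have h3 : 0 ≤ w ^ 2 * (A⁻¹ - B⁻¹) ^ 2 := by positivity
  nlinarith

/-- The map `(m, k) ↦ (k - m, k)`. -/
def convEquiv : (Fin 3 → ℤ) × (Fin 3 → ℤ) ≃ (Fin 3 → ℤ) × (Fin 3 → ℤ) where
  toFun p := (p.2 - p.1, p.2)
  invFun p := (p.2 - p.1, p.2)
  left_inv p := by simp
  right_inv p := by simp

/-- The map `(m, k) ↦ (m, k - m)`. -/
def shearEquiv : (Fin 3 → ℤ) × (Fin 3 → ℤ) ≃ (Fin 3 → ℤ) × (Fin 3 → ℤ) where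
  toFun p := (p.1, p.2 - p.1)
  invFun p := (p.1, p.2 + p.1)
  left_inv p := by simp
  right_inv p := by simp

/-- Parseval for the pair exp(2πi m·x)ψ and ψ, since modulation shifts frequencies. -/
theorem mFourierCoeff_norm_sq {ψ : T3 → ℂ} (hψ : MemLp ψ 2 torusMeasure) (m : Fin 3 → ℤ) :
    HasSum (fun k => conj (mFourierCoeff ψ (k - m)) * mFourierCoeff ψ k)
      (mFourierCoeff (fun x => ((‖ψ x‖ ^ 2 : ℝ) : ℂ)) m) := by
  have hm : MemLp (fun x => mFourier m x * ψ x) 2 torusMeasure := by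
    refine hψ.of_le ((mFourier m).continuous.aestronglyMeasurable.mul hψ.1)
      (.of_forall fun x => ?_)
    rw [norm_mul, norm_mFourier_apply, one_mul]
  have h := hasSum_conj_mul_mFourierCoeff hm hψ
  simp only [mFourierCoeff_mFourier_mul] at h
  convert h using 1
  rw [mFourierCoeff_eq]
  refine integral_congr_ae (.of_forall fun x => ?_)
  simp only [map_mul, mFourier_neg, mul_assoc, Complex.conj_mul', Complex.ofReal_pow]

/-- The Fourier coefficients of `|ψ|²` for `ψ ∈ H¹` are summable against `greenWeight`, with a
bound depending only on the `H¹` norm. -/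
theorem greenWeight_mFourierCoeff_norm_sq {ψ : T3 → ℂ} (hψ : MemSobolev 1 ψ) :
    (Summable fun m => greenWeight m * ‖mFourierCoeff (fun x => ((‖ψ x‖ ^ 2 : ℝ) : ℂ)) m‖) ∧
    ∑' m, greenWeight m * ‖mFourierCoeff (fun x => ((‖ψ x‖ ^ 2 : ℝ) : ℂ)) m‖ ≤
      1 / 2 * (∑' m, (1 + freqSq m) * ‖mFourierCoeff ψ m‖ ^ 2) ^ 2 +
        1 / 2 * ((∑' m, greenWeight m ^ 2) * ∑' m, ((1 + freqSq m)⁻¹) ^ 2) := by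
  obtain ⟨hψ2, hs⟩ := hψ
  simp only [pow_one] at hs
  set a : (Fin 3 → ℤ) → ℝ := fun m => (1 + freqSq m) * ‖mFourierCoeff ψ m‖ ^ 2 with ha
  set b : (Fin 3 → ℤ) → ℝ := fun m => ((1 + freqSq m)⁻¹) ^ 2 with hb
  have ha0 : ∀ m, 0 ≤ a m := fun m => by
    have := one_add_freqSq_pos m
    positivity
  have hb0 : ∀ m, 0 ≤ b m := fun m => sq_nonneg _
  have hbs : Summable b := summable_inv_one_add_freqSq_sq
  have hw := summable_greenWeight_sq
  have h1 := hs.hasSum.mul hs.hasSum (hs.mul_of_nonneg hs ha0 ha0)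
  have h2 := hw.hasSum.mul hbs.hasSum (hw.mul_of_nonneg hbs (fun m => sq_nonneg _) hb0)
  -- Both reindexings rewrite sums over independent frequencies as sums over (m, k): the first
  -- yields a(k − m)a(k), the second w(m)²b(k − m).
  have h1' := (convEquiv.hasSum_iff).2 h1
  have h2' := (shearEquiv.hasSum_iff).2 h2
  have hT := (h1'.mul_left (1 / 2)).add ((h2'.mul_left (1 / 4)).add (h2.mul_left (1 / 4)))
  have hfib := hT.prod_fiberwise fun m => (hT.summable.prod_factor m).hasSum
  have hle : ∀ m, greenWeight m * ‖mFourierCoeff (fun x => ((‖ψ x‖ ^ 2 : ℝ) : ℂ)) m‖ ≤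
      ∑' k, (1 / 2 * ((fun p : (Fin 3 → ℤ) × (Fin 3 → ℤ) => a p.1 * a p.2) ∘ convEquiv) (m, k) +
        (1 / 4 * ((fun p : (Fin 3 → ℤ) × (Fin 3 → ℤ) => greenWeight p.1 ^ 2 * b p.2) ∘ shearEquiv)
          (m, k) + 1 / 4 * (greenWeight m ^ 2 * b k))) := fun m => by
    have h := ((mFourierCoeff_norm_sq hψ2 m).mul_left (greenWeight m : ℂ))
    calc _ = ‖(greenWeight m : ℂ) * mFourierCoeff (fun x => ((‖ψ x‖ ^ 2 : ℝ) : ℂ)) m‖ := by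
          rw [norm_mul, Complex.norm_real, Real.norm_of_nonneg (greenWeight_nonneg m)]
      _ ≤ _ := by
          rw [← h.tsum_eq]
          refine tsum_of_norm_bounded (hT.summable.prod_factor m).hasSum fun k => ?_
          rw [norm_mul, norm_mul, Complex.norm_real, Real.norm_of_nonneg (greenWeight_nonneg m),
            RCLike.norm_conj]
          exact mul_mul_le_of_pos (one_add_freqSq_pos _) (one_add_freqSq_pos _)
  have hsum := Summable.of_nonneg_of_le
    (fun m => mul_nonneg (greenWeight_nonneg m) (norm_nonneg _)) hle hfib.summable
  refine ⟨hsum, (hsum.tsum_le_tsum hle hfib.summable).trans ?_⟩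
  rw [hfib.tsum_eq]
  apply le_of_eq
  ring

/-- The Fourier coefficients of an `L²` function are summable against `greenWeight`. -/
theorem summable_greenWeight_of_memLp {f : T3 → ℂ} (hf : MemLp f 2 torusMeasure) :
    Summable fun m => greenWeight m * ‖mFourierCoeff f m‖ := by
  refine Summable.of_nonneg_of_le (fun m => mul_nonneg (greenWeight_nonneg m) (norm_nonneg _))
    (fun m => ?_) (summable_greenWeight_sq.add (hasSum_norm_sq_mFourierCoeff hf).summable)
  nlinarith [sq_nonneg (greenWeight m - ‖mFourierCoeff f m‖), sq_nonneg (greenWeight m),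
    sq_nonneg (‖mFourierCoeff f m‖)]

/-! ### Sobolev functions and the Schrödinger form -/

theorem memSobolev_add_const_mul {s : ℕ} {u v : T3 → ℂ} (hu : MemSobolev s u)
    (hv : MemSobolev s v) (c : ℂ) : MemSobolev s fun x => u x + c * v x := by
  refine ⟨hu.1.add (hv.1.const_mul c), ?_⟩
  refine Summable.of_nonneg_of_le (fun m => ?_) (fun m => ?_)
    ((hu.2.mul_left 2).add (hv.2.mul_left (2 * ‖c‖ ^ 2)))
  · have := one_add_freqSq_pos m
    positivity
  · have h0 := one_add_freqSq_pos m
    rw [mFourierCoeff_add_const_mul (hu.1.integrable one_le_two) (hv.1.integrable one_le_two)]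
    have h1 := norm_add_le (mFourierCoeff u m) (c * mFourierCoeff v m)
    rw [norm_mul] at h1
    have h2 : ‖mFourierCoeff u m + c * mFourierCoeff v m‖ ^ 2
        ≤ 2 * ‖mFourierCoeff u m‖ ^ 2 + 2 * ‖c‖ ^ 2 * ‖mFourierCoeff v m‖ ^ 2 := by
      calc _ ≤ (‖mFourierCoeff u m‖ + ‖c‖ * ‖mFourierCoeff v m‖) ^ 2 := by gcongr
        _ ≤ _ := by nlinarith [sq_nonneg (‖mFourierCoeff u m‖ - ‖c‖ * ‖mFourierCoeff v m‖)]
    calc _ ≤ (1 + freqSq m) ^ s *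
          (2 * ‖mFourierCoeff u m‖ ^ 2 + 2 * ‖c‖ ^ 2 * ‖mFourierCoeff v m‖ ^ 2) := by gcongr
      _ = _ := by ring

theorem memSobolev_mFourier (s : ℕ) (n : Fin 3 → ℤ) : MemSobolev s (mFourier n) := by
  refine ⟨memLp_mFourier n 2, summable_of_ne_finset_zero (s := {n}) fun m hm => ?_⟩
  rw [mFourierCoeff_mFourier, if_neg (by simpa using hm)]
  simp

theorem memSobolev_const (s : ℕ) (c : ℂ) : MemSobolev s fun _ => c := by
  refine ⟨memLp_const c, summable_of_ne_finset_zero (s := {0}) fun m hm => ?_⟩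
  rw [mFourierCoeff_const, if_neg (by simpa using hm)]
  simp

theorem summable_freqSq_mul_norm_sq {u : T3 → ℂ} (hu : MemSobolev 1 u) :
    Summable fun m => freqSq m * ‖mFourierCoeff u m‖ ^ 2 := by
  refine Summable.of_nonneg_of_le (fun m => mul_nonneg (freqSq_nonneg m) (sq_nonneg _))
    (fun m => ?_) hu.2
  rw [pow_one]
  gcongr
  linarith

theorem summable_dirichletForm {u v : T3 → ℂ} (hu : MemSobolev 1 u) (hv : MemSobolev 1 v) :
    Summable fun m => (freqSq m : ℂ) * (conj (mFourierCoeff u m) * mFourierCoeff v m) := by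
  refine Summable.of_norm_bounded
    ((summable_freqSq_mul_norm_sq hu).add (summable_freqSq_mul_norm_sq hv)) fun m => ?_
  rw [norm_mul, norm_mul, RCLike.norm_conj, Complex.norm_real,
    Real.norm_of_nonneg (freqSq_nonneg m), ← mul_add]
  refine mul_le_mul_of_nonneg_left ?_ (freqSq_nonneg m)
  nlinarith [sq_nonneg (‖mFourierCoeff u m‖ - ‖mFourierCoeff v m‖), norm_nonneg (mFourierCoeff u m),
    norm_nonneg (mFourierCoeff v m), mul_nonneg (norm_nonneg (mFourierCoeff u m))
      (norm_nonneg (mFourierCoeff v m))]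

theorem dirichletForm_add_const_mul {u v w : T3 → ℂ} (hu : MemSobolev 1 u) (hv : MemSobolev 1 v)
    (hw : MemSobolev 1 w) (c : ℂ) :
    dirichletForm u (fun x => v x + c * w x) = dirichletForm u v + c * dirichletForm u w := by
  unfold dirichletForm
  rw [← tsum_mul_left, ← (summable_dirichletForm hu hv).tsum_add
    ((summable_dirichletForm hu hw).mul_left c)]
  congr 1
  funext m
  rw [mFourierCoeff_add_const_mul (hv.1.integrable one_le_two) (hw.1.integrable one_le_two)]
  ring

theorem dirichletForm_conj (u v : T3 → ℂ) : conj (dirichletForm u v) = dirichletForm v u := by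
  unfold dirichletForm
  rw [Complex.conj_tsum]
  congr 1
  funext m
  simp only [map_mul, Complex.conj_ofReal, Complex.conj_conj]
  ring

theorem dirichletForm_self (u : T3 → ℂ) :
    dirichletForm u u = ((∑' m, freqSq m * ‖mFourierCoeff u m‖ ^ 2 : ℝ) : ℂ) := by
  unfold dirichletForm
  rw [Complex.ofReal_tsum]
  congr 1
  funext m
  rw [Complex.conj_mul']
  push_cast
  rfl

theorem dirichletForm_mFourier (n : Fin 3 → ℤ) (v : T3 → ℂ) :
    dirichletForm (mFourier n) v = freqSq n * mFourierCoeff v n := by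
  unfold dirichletForm
  rw [tsum_eq_single n fun m hm => by rw [mFourierCoeff_mFourier, if_neg hm]; simp]
  rw [mFourierCoeff_mFourier, if_pos rfl]
  simp

section SchrodingerForm

variable {e ω b : ℝ} {Φ : T3 → ℝ}

theorem memLp_potential_mul (hΦ : Continuous Φ) (hb : ∀ x, |Φ x| ≤ b) {v : T3 → ℂ}
    (hv : MemLp v 2 torusMeasure) : MemLp (fun x => (Φ x : ℂ) * v x) 2 torusMeasure := by
  refine hv.of_le_mul (c := b)
    ((Complex.continuous_ofReal.comp hΦ).aestronglyMeasurable.mul hv.1) (.of_forall fun x => ?_)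
  rw [norm_mul, Complex.norm_real, Real.norm_eq_abs]
  gcongr
  exact hb x

theorem integrable_potential_mul (hΦ : Continuous Φ) (hb : ∀ x, |Φ x| ≤ b) {u v : T3 → ℂ}
    (hu : MemLp u 2 torusMeasure) (hv : MemLp v 2 torusMeasure) :
    Integrable (fun x => (Φ x : ℂ) * (conj (u x) * v x)) torusMeasure := by
  refine (integrable_conj_mul hu (memLp_potential_mul hΦ hb hv)).congr (.of_forall fun x => ?_)
  ring

theorem schrodingerForm_add_const_mul (hΦ : Continuous Φ) (hb : ∀ x, |Φ x| ≤ b)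
    {u v w : T3 → ℂ} (hu : MemSobolev 1 u) (hv : MemSobolev 1 v) (hw : MemSobolev 1 w) (c : ℂ) :
    schrodingerForm e Φ ω u (fun x => v x + c * w x)
      = schrodingerForm e Φ ω u v + c * schrodingerForm e Φ ω u w := by
  have h1 : ∫ x, (Φ x : ℂ) * (conj (u x) * (v x + c * w x)) ∂torusMeasure
      = ∫ x, (Φ x : ℂ) * (conj (u x) * v x) ∂torusMeasure
        + c * ∫ x, (Φ x : ℂ) * (conj (u x) * w x) ∂torusMeasure := by
    rw [← integral_const_mul, ← integral_add (integrable_potential_mul hΦ hb hu.1 hv.1)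
      ((integrable_potential_mul hΦ hb hu.1 hw.1).const_mul c)]
    refine integral_congr_ae (.of_forall fun x => ?_)
    ring
  have h2 : ∫ x, conj (u x) * (v x + c * w x) ∂torusMeasure
      = ∫ x, conj (u x) * v x ∂torusMeasure + c * ∫ x, conj (u x) * w x ∂torusMeasure := by
    rw [← integral_const_mul, ← integral_add (integrable_conj_mul hu.1 hv.1)
      ((integrable_conj_mul hu.1 hw.1).const_mul c)]
    refine integral_congr_ae (.of_forall fun x => ?_)
    ring
  unfold schrodingerForm
  rw [dirichletForm_add_const_mul hu hv hw, h1, h2]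
  ring

theorem schrodingerForm_conj (e ω : ℝ) (Φ : T3 → ℝ) (u v : T3 → ℂ) :
    conj (schrodingerForm e Φ ω u v) = schrodingerForm e Φ ω v u := by
  unfold schrodingerForm
  simp only [map_sub, map_mul, dirichletForm_conj, Complex.conj_ofReal, ← integral_conj,
    Complex.conj_conj, map_div₀, map_one, map_ofNat]
  simp only [mul_comm (u _)]

/-- `⟨u, H u⟩` in terms of Fourier coefficients and the `L²` norm. -/
theorem schrodingerForm_self (e ω : ℝ) (Φ : T3 → ℝ) (u : T3 → ℂ) :
    schrodingerForm e Φ ω u u = ((1 / 2 * ∑' m, freqSq m * ‖mFourierCoeff u m‖ ^ 2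
      - e * ∫ x, Φ x * ‖u x‖ ^ 2 ∂torusMeasure - ω * ∫ x, ‖u x‖ ^ 2 ∂torusMeasure : ℝ) : ℂ) := by
  unfold schrodingerForm
  rw [dirichletForm_self]
  simp only [Complex.conj_mul', ← Complex.ofReal_pow, ← Complex.ofReal_mul,
    integral_complex_ofReal]
  push_cast
  ring

theorem abs_integral_potential_mul_norm_sq_le (hb : ∀ x, |Φ x| ≤ b) {u : T3 → ℂ}
    (hu : MemLp u 2 torusMeasure) :
    |∫ x, Φ x * ‖u x‖ ^ 2 ∂torusMeasure| ≤ b * ∫ x, ‖u x‖ ^ 2 ∂torusMeasure := by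
  rw [← integral_const_mul, ← Real.norm_eq_abs]
  refine norm_integral_le_of_norm_le ((integrable_norm_sq hu).const_mul b)
    (.of_forall fun x => ?_)
  rw [Real.norm_eq_abs, abs_mul, abs_of_nonneg (sq_nonneg ‖u x‖)]
  gcongr
  exact hb x

/-- Coercivity of the Schrödinger form on functions of mean zero. -/
theorem schrodingerForm_self_re_nonneg (he : 0 ≤ e) (hb : ∀ x, |Φ x| ≤ b) {u : T3 → ℂ}
    (hu : MemSobolev 1 u) (hu0 : mFourierCoeff u 0 = 0) (hsmall : e * b + |ω| ≤ 1 / 2) :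
    0 ≤ (schrodingerForm e Φ ω u u).re := by
  rw [schrodingerForm_self, Complex.ofReal_re]
  have hN := hasSum_norm_sq_mFourierCoeff hu.1
  -- Poincaré's inequality: the only mode of zero weight is absent.
  have h1 : ∫ x, ‖u x‖ ^ 2 ∂torusMeasure ≤ ∑' m, freqSq m * ‖mFourierCoeff u m‖ ^ 2 := by
    rw [← hN.tsum_eq]
    refine hN.summable.tsum_le_tsum (fun m => ?_) (summable_freqSq_mul_norm_sq hu)
    by_cases hm : m = 0
    · simp [hm, hu0]
    · exact le_mul_of_one_le_left (sq_nonneg _) (one_le_freqSq hm)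
  have hI : 0 ≤ ∫ x, ‖u x‖ ^ 2 ∂torusMeasure := integral_nonneg fun x => sq_nonneg _
  have h2 := mul_le_mul_of_nonneg_left
    ((le_abs_self _).trans (abs_integral_potential_mul_norm_sq_le hb hu.1)) he
  have h3 := mul_le_mul_of_nonneg_right (le_abs_self ω) hI
  have h4 := mul_le_mul_of_nonneg_right hsmall hI
  nlinarith

/-- A Schrödinger form which annihilates a function of nonzero mean is nonnegative, provided that
the potential is small. -/
theorem schrodingerForm_nonneg_of_stationary (he : 0 ≤ e) (hΦ : Continuous Φ)
    (hb : ∀ x, |Φ x| ≤ b) (hsmall : e * b + |ω| ≤ 1 / 2) {ψ : T3 → ℂ} (hψ : MemSobolev 1 ψ)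
    (hψ0 : mFourierCoeff ψ 0 ≠ 0)
    (hst : ∀ v : T3 → ℂ, MemSobolev 1 v → schrodingerForm e Φ ω v ψ = 0)
    {u : T3 → ℂ} (hu : MemSobolev 1 u) : 0 ≤ (schrodingerForm e Φ ω u u).re := by
  -- Chosen so that u − cψ has mean zero.
  set c := mFourierCoeff u 0 / mFourierCoeff ψ 0 with hc
  set w : T3 → ℂ := fun x => u x + (-c) * ψ x with hw
  have hwS : MemSobolev 1 w := memSobolev_add_const_mul hu hψ (-c)
  have hw0 : mFourierCoeff w 0 = 0 := by
    rw [hw, mFourierCoeff_add_const_mul (hu.1.integrable one_le_two)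
      (hψ.1.integrable one_le_two), hc]
    field_simp
    ring
  have h1 : ∀ v : T3 → ℂ, MemSobolev 1 v →
      schrodingerForm e Φ ω v w = schrodingerForm e Φ ω v u := fun v hv => by
    rw [hw, schrodingerForm_add_const_mul hΦ hb hv hu hψ, hst v hv]
    ring
  have h2 : schrodingerForm e Φ ω u u = schrodingerForm e Φ ω w w := by
    -- Stationarity removes ψ from the right slot only; Hermitian symmetry transfers this to the
    -- left slot.
    rw [← h1 u hu, ← schrodingerForm_conj, ← h1 w hwS, schrodingerForm_conj]
  rw [h2]
  exact schrodingerForm_self_re_nonneg he hb hwS hw0 hsmall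

/-- A weak solution is a strong solution on the Fourier side. -/
theorem freqSq_mul_mFourierCoeff_of_stationary (hΦ : Continuous Φ) (hb : ∀ x, |Φ x| ≤ b)
    {ψ : T3 → ℂ} (hψ : MemSobolev 1 ψ)
    (hst : ∀ v : T3 → ℂ, MemSobolev 1 v → schrodingerForm e Φ ω v ψ = 0) (m : Fin 3 → ℤ) :
    (freqSq m : ℂ) * mFourierCoeff ψ m
      = 2 * mFourierCoeff (fun x => ((ω + e * Φ x : ℝ) : ℂ) * ψ x) m := by
  have h := hst _ (memSobolev_mFourier 1 m)
  unfold schrodingerForm at h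
  rw [dirichletForm_mFourier] at h
  have h1 : mFourierCoeff (fun x => ((ω + e * Φ x : ℝ) : ℂ) * ψ x) m
      = ω * ∫ x, conj (mFourier m x) * ψ x ∂torusMeasure
        + e * ∫ x, (Φ x : ℂ) * (conj (mFourier m x) * ψ x) ∂torusMeasure := by
    rw [mFourierCoeff_eq, ← integral_const_mul, ← integral_const_mul, ← integral_add
      ((integrable_conj_mul (memLp_mFourier m 2) hψ.1).const_mul _)
      ((integrable_potential_mul hΦ hb (memLp_mFourier m 2) hψ.1).const_mul _)]
    refine integral_congr_ae (.of_forall fun x => ?_)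
    simp only [mFourier_neg]
    push_cast
    ring
  rw [h1]
  linear_combination 2 * h

/-- `H²` estimate for the oscillating part of a weak solution. -/
theorem memSobolev_two_of_stationary (he : 0 ≤ e) (hΦ : Continuous Φ) (hb : ∀ x, |Φ x| ≤ b)
    {ψ : T3 → ℂ} (hψ : MemSobolev 1 ψ)
    (hst : ∀ v : T3 → ℂ, MemSobolev 1 v → schrodingerForm e Φ ω v ψ = 0) :
    MemSobolev 2 (fun x => ψ x + (-mFourierCoeff ψ 0) * 1) ∧
    sobolevNorm 2 (fun x => ψ x + (-mFourierCoeff ψ 0) * 1) ^ 2 ≤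
      16 * (|ω| + e * b) ^ 2 * ∫ x, ‖ψ x‖ ^ 2 ∂torusMeasure ∧
    |‖mFourierCoeff ψ 0‖ ^ 2 - ∫ x, ‖ψ x‖ ^ 2 ∂torusMeasure| ≤
      16 * (|ω| + e * b) ^ 2 * ∫ x, ‖ψ x‖ ^ 2 ∂torusMeasure := by
  set χ : T3 → ℂ := fun x => ψ x + (-mFourierCoeff ψ 0) * 1 with hχ
  have hcoef : ∀ m, mFourierCoeff χ m = if m = 0 then 0 else mFourierCoeff ψ m := fun m => by
    rw [hχ, mFourierCoeff_add_const_mul (hψ.1.integrable one_le_two) (integrable_const 1),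
      mFourierCoeff_const]
    split_ifs with hm <;> simp [hm]
  have hbound : ∀ x, |ω + e * Φ x| ≤ |ω| + e * b := fun x => by
    refine (abs_add_le _ _).trans ?_
    rw [abs_mul, abs_of_nonneg he]
    gcongr
    exact hb x
  have hL : MemLp (fun x => ((ω + e * Φ x : ℝ) : ℂ) * ψ x) 2 torusMeasure :=
    memLp_potential_mul (by fun_prop) hbound hψ.1
  have hP := hasSum_norm_sq_mFourierCoeff hL
  have hint : ∫ x, ‖((ω + e * Φ x : ℝ) : ℂ) * ψ x‖ ^ 2 ∂torusMeasure ≤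
      (|ω| + e * b) ^ 2 * ∫ x, ‖ψ x‖ ^ 2 ∂torusMeasure := by
    rw [← integral_const_mul]
    refine integral_mono (integrable_norm_sq hL) ((integrable_norm_sq hψ.1).const_mul _)
      fun x => ?_
    simp only [norm_mul, mul_pow, Complex.norm_real, Real.norm_eq_abs]
    gcongr
    exact hbound x
  -- The factor 16 is 4 from 1 + λ ≤ 2λ for λ ≥ 1, squared, times 4 from the factor 2 in the
  -- equation, squared.
  have hle : ∀ m, (1 + freqSq m) ^ 2 * ‖mFourierCoeff χ m‖ ^ 2 ≤
      16 * ‖mFourierCoeff (fun x => ((ω + e * Φ x : ℝ) : ℂ) * ψ x) m‖ ^ 2 := fun m => by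
    rw [hcoef]
    split_ifs with hm
    · simp
    · have h := congrArg norm (freqSq_mul_mFourierCoeff_of_stationary hΦ hb hψ hst m)
      rw [norm_mul, norm_mul, Complex.norm_real, Real.norm_of_nonneg (freqSq_nonneg m),
        Complex.norm_ofNat] at h
      have h1 := one_le_freqSq hm
      calc (1 + freqSq m) ^ 2 * ‖mFourierCoeff ψ m‖ ^ 2
          ≤ (2 * freqSq m) ^ 2 * ‖mFourierCoeff ψ m‖ ^ 2 := by
            gcongr
            linarith
        _ = 4 * (freqSq m * ‖mFourierCoeff ψ m‖) ^ 2 := by ring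
        _ = _ := by
          rw [h]
          ring
  have h0 : ∀ m, 0 ≤ (1 + freqSq m) ^ 2 * ‖mFourierCoeff χ m‖ ^ 2 := fun m => by positivity
  have hχs : Summable fun m => (1 + freqSq m) ^ 2 * ‖mFourierCoeff χ m‖ ^ 2 :=
    .of_nonneg_of_le h0 hle (hP.summable.mul_left 16)
  have htot : ∑' m, (1 + freqSq m) ^ 2 * ‖mFourierCoeff χ m‖ ^ 2 ≤
      16 * (|ω| + e * b) ^ 2 * ∫ x, ‖ψ x‖ ^ 2 ∂torusMeasure := by
    have h1 := hχs.tsum_le_tsum hle (hP.summable.mul_left 16)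
    rw [tsum_mul_left, hP.tsum_eq] at h1
    linarith
  have hχL : MemLp χ 2 torusMeasure := hψ.1.add (memLp_const _)
  refine ⟨⟨hχL, hχs⟩, ?_, ?_⟩
  · unfold sobolevNorm
    rw [Real.sq_sqrt (tsum_nonneg h0)]
    exact htot
  -- Splitting the zero mode off Parseval's sum leaves the squared L² norm of χ, which the H² sum
  -- dominates.
  · have h1 := hasSum_norm_sq_mFourierCoeff hψ.1
    have h2 := h1.summable.tsum_eq_add_tsum_ite 0
    rw [h1.tsum_eq] at h2
    have h3 : ∀ m, (if m = 0 then 0 else ‖mFourierCoeff ψ m‖ ^ 2) = ‖mFourierCoeff χ m‖ ^ 2 :=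
      fun m => by
        rw [hcoef]
        split_ifs <;> simp
    simp only [h3] at h2
    have h4 : ∑' m, ‖mFourierCoeff χ m‖ ^ 2
        ≤ ∑' m, (1 + freqSq m) ^ 2 * ‖mFourierCoeff χ m‖ ^ 2 := by
      refine (hasSum_norm_sq_mFourierCoeff hχL).summable.tsum_le_tsum (fun m => ?_) hχs
      refine le_mul_of_one_le_left (sq_nonneg _) (one_le_pow₀ ?_)
      linarith [freqSq_nonneg m]
    have h5 : 0 ≤ ∑' m, ‖mFourierCoeff χ m‖ ^ 2 := tsum_nonneg fun m => sq_nonneg _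
    rw [h2, sub_add_cancel_left, abs_neg, abs_of_nonneg h5, ← h2]
    exact h4.trans htot

end SchrodingerForm

/-! ### Minimizing ground states -/

/-- This scaling makes every power of e explicit, leaving unit-charge quantities to be bounded
uniformly in e. -/
theorem chargeDensity_const_mul (e : ℝ) (μ : (Fin 3 → ℝ) → ℝ) (ψ : T3 → ℂ) :
    chargeDensity e (fun x => e * μ x) ψ = fun x => e * chargeDensity 1 μ ψ x := by
  funext x
  simp only [chargeDensity, periodize, tsum_mul_left]
  ring

theorem potential_const_mul (e : ℝ) (μ : (Fin 3 → ℝ) → ℝ) (ψ : T3 → ℂ) :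
    potential e (fun x => e * μ x) ψ = fun x => e * potential 1 μ ψ x := by
  rw [potential, chargeDensity_const_mul, perGreen_const_mul]
  rfl

/-- The electrostatic energy of unit charge. -/
noncomputable def coulombEnergy (μ : (Fin 3 → ℝ) → ℝ) (ψ : T3 → ℂ) : ℝ :=
  ∫ x, chargeDensity 1 μ ψ x * potential 1 μ ψ x ∂torusMeasure

theorem cellEnergy_const_mul (e : ℝ) (μ : (Fin 3 → ℝ) → ℝ) (ψ : T3 → ℂ) :
    cellEnergy e (fun x => e * μ x) ψ
      = 1 / 2 * (∑' m, freqSq m * ‖mFourierCoeff ψ m‖ ^ 2 + e ^ 2 * coulombEnergy μ ψ) := by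
  unfold cellEnergy coulombEnergy
  rw [dirichletForm_self, Complex.ofReal_re, chargeDensity_const_mul, perGreen_const_mul,
    ← integral_const_mul]
  congr 2
  refine integral_congr_ae (.of_forall fun x => ?_)
  simp only [potential]
  ring

/-! ### Bounds for the unit-charge potential and energy -/

section Density

variable {μ : (Fin 3 → ℝ) → ℝ} {ψ : T3 → ℂ}

theorem integrable_chargeDensity (hμ : MemLp (periodize μ) 2 torusMeasure)
    (hψ : MemLp ψ 2 torusMeasure) : Integrable (chargeDensity 1 μ ψ) torusMeasure :=
  (hμ.integrable one_le_two).sub ((integrable_norm_sq hψ).const_mul 1)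

theorem greenWeight_chargeDensity_le (hμ : MemLp (periodize μ) 2 torusMeasure)
    (hψ : MemLp ψ 2 torusMeasure) (m : Fin 3 → ℤ) :
    greenWeight m * ‖mFourierCoeff (fun x => (chargeDensity 1 μ ψ x : ℂ)) m‖ ≤
      greenWeight m * ‖mFourierCoeff (fun x => (periodize μ x : ℂ)) m‖ +
        greenWeight m * ‖mFourierCoeff (fun x => ((‖ψ x‖ ^ 2 : ℝ) : ℂ)) m‖ := by
  have h : mFourierCoeff (fun x => (chargeDensity 1 μ ψ x : ℂ)) m
      = mFourierCoeff (fun x => (periodize μ x : ℂ)) m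
        + (-1) * mFourierCoeff (fun x => ((‖ψ x‖ ^ 2 : ℝ) : ℂ)) m := by
    rw [← mFourierCoeff_add_const_mul (f := fun x => (periodize μ x : ℂ))
      (g := fun x => ((‖ψ x‖ ^ 2 : ℝ) : ℂ)) (hμ.integrable one_le_two).ofReal
      (integrable_norm_sq hψ).ofReal]
    congr 1
    funext x
    simp only [chargeDensity]
    push_cast
    ring
  rw [h, ← mul_add]
  refine mul_le_mul_of_nonneg_left ?_ (greenWeight_nonneg m)
  refine (norm_add_le _ _).trans ?_
  simp

theorem summable_greenWeight_chargeDensity (hμ : MemLp (periodize μ) 2 torusMeasure)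
    (hψ : MemSobolev 1 ψ) :
    Summable fun m => greenWeight m * ‖mFourierCoeff (fun x => (chargeDensity 1 μ ψ x : ℂ)) m‖ :=
  .of_nonneg_of_le (fun m => mul_nonneg (greenWeight_nonneg m) (norm_nonneg _))
    (greenWeight_chargeDensity_le hμ hψ.1)
    ((summable_greenWeight_of_memLp (f := fun x => (periodize μ x : ℂ)) hμ.ofReal).add
      (greenWeight_mFourierCoeff_norm_sq hψ).1)

theorem continuous_potential (hμ : MemLp (periodize μ) 2 torusMeasure) (hψ : MemSobolev 1 ψ) :
    Continuous (potential 1 μ ψ) :=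
  continuous_perGreen (summable_greenWeight_chargeDensity hμ hψ)

/-- The uniform bound of the potential in terms of the squared `H¹` norm. -/
noncomputable def potentialBound (μ : (Fin 3 → ℝ) → ℝ) (R : ℝ) : ℝ :=
  ∑' m, greenWeight m * ‖mFourierCoeff (fun x => (periodize μ x : ℂ)) m‖ +
    (1 / 2 * R ^ 2 + 1 / 2 * ((∑' m, greenWeight m ^ 2) * ∑' m, ((1 + freqSq m)⁻¹) ^ 2))

theorem potentialBound_nonneg (μ : (Fin 3 → ℝ) → ℝ) (R : ℝ) : 0 ≤ potentialBound μ R := by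
  have h1 : 0 ≤ ∑' m, greenWeight m * ‖mFourierCoeff (fun x => (periodize μ x : ℂ)) m‖ :=
    tsum_nonneg fun m => mul_nonneg (greenWeight_nonneg m) (norm_nonneg _)
  have h2 : 0 ≤ ∑' m, greenWeight m ^ 2 := tsum_nonneg fun m => sq_nonneg _
  have h3 : 0 ≤ ∑' m, ((1 + freqSq m)⁻¹) ^ 2 := tsum_nonneg fun m => sq_nonneg _
  unfold potentialBound
  positivity

theorem abs_potential_le (hμ : MemLp (periodize μ) 2 torusMeasure) (hψ : MemSobolev 1 ψ) {R : ℝ}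
    (hR : ∑' m, (1 + freqSq m) * ‖mFourierCoeff ψ m‖ ^ 2 ≤ R) (x : T3) :
    |potential 1 μ ψ x| ≤ potentialBound μ R := by
  have hs := summable_greenWeight_chargeDensity hμ hψ
  have h1 := summable_greenWeight_of_memLp (f := fun x => (periodize μ x : ℂ)) hμ.ofReal
  obtain ⟨h2, h3⟩ := greenWeight_mFourierCoeff_norm_sq hψ
  have h0 : 0 ≤ ∑' m, (1 + freqSq m) * ‖mFourierCoeff ψ m‖ ^ 2 :=
    tsum_nonneg fun m => mul_nonneg (one_add_freqSq_pos m).le (sq_nonneg _)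
  refine (abs_perGreen_le hs x).trans
    ((hs.tsum_le_tsum (greenWeight_chargeDensity_le hμ hψ.1) (h1.add h2)).trans ?_)
  rw [h1.tsum_add h2]
  unfold potentialBound
  gcongr
  refine h3.trans ?_
  gcongr

theorem coulombEnergy_nonneg (hμ : MemLp (periodize μ) 2 torusMeasure) (hψ : MemSobolev 1 ψ) :
    0 ≤ coulombEnergy μ ψ :=
  integral_mul_perGreen_nonneg (integrable_chargeDensity hμ hψ.1)
    (summable_greenWeight_chargeDensity hμ hψ)

end Density

/-! ### Estimates for minimizing ground states -/

section GroundState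

variable {μ : (Fin 3 → ℝ) → ℝ} {ψ : T3 → ℂ} {e Z ω : ℝ}

/-- Comparison with the constant function of the same mass. -/
theorem tsum_freqSq_le_of_isGroundState (hμ : MemLp (periodize μ) 2 torusMeasure) (hZ : 0 ≤ Z)
    (h : IsGroundState e (fun x => e * μ x) Z ψ ω) :
    ∑' m, freqSq m * ‖mFourierCoeff ψ m‖ ^ 2
      ≤ e ^ 2 * coulombEnergy μ fun _ => ((Real.sqrt Z : ℝ) : ℂ) := by
  have hc : (fun _ => ((Real.sqrt Z : ℝ) : ℂ)) ∈ admissible Z := by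
    refine ⟨memSobolev_const 1 _, ?_⟩
    simp [Real.sq_sqrt hZ]
  have hmin := isMinOn_iff.1 h.isMin _ hc
  have h0 : ∑' m, freqSq m * ‖mFourierCoeff (fun _ : T3 => ((Real.sqrt Z : ℝ) : ℂ)) m‖ ^ 2 = 0 := by
    rw [← tsum_zero]
    congr 1
    funext m
    rw [mFourierCoeff_const]
    split_ifs with hm <;> simp [hm, freqSq_zero]
  rw [cellEnergy_const_mul, cellEnergy_const_mul, h0] at hmin
  -- The Coulomb energy of ψ is nonnegative and can be dropped.
  have := mul_nonneg (sq_nonneg e) (coulombEnergy_nonneg hμ h.mem.1)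
  linarith

/-- The squared H¹ norm is the mass Z plus the Dirichlet energy, and the latter is at most the
Coulomb energy of the constant once e² ≤ 1. The bound thus depends on neither e nor ψ. -/
theorem abs_potential_le_of_isGroundState (hμ : MemLp (periodize μ) 2 torusMeasure) (hZ : 0 ≤ Z)
    (he : e ^ 2 ≤ 1) (h : IsGroundState e (fun x => e * μ x) Z ψ ω) (x : T3) :
    |potential 1 μ ψ x|
      ≤ potentialBound μ (Z + coulombEnergy μ fun _ => ((Real.sqrt Z : ℝ) : ℂ)) := by
  refine abs_potential_le hμ h.mem.1 ?_ x
  have h1 := hasSum_norm_sq_mFourierCoeff h.mem.1.1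
  have h2 := summable_freqSq_mul_norm_sq h.mem.1
  have h3 := tsum_freqSq_le_of_isGroundState hμ hZ h
  have h4 := mul_le_mul_of_nonneg_right he
    (coulombEnergy_nonneg hμ (memSobolev_const 1 ((Real.sqrt Z : ℝ) : ℂ)))
  simp only [add_mul, one_mul]
  rw [h1.summable.tsum_add h2, h1.tsum_eq, h.mem.2]
  linarith

/-- The frequency of a ground state is controlled by its energy. -/
theorem abs_omega_mul_le_of_isGroundState (hμ : MemLp (periodize μ) 2 torusMeasure) (hZ : 0 ≤ Z)
    {B : ℝ} (hB : ∀ x, |potential 1 μ ψ x| ≤ B)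
    (h : IsGroundState e (fun x => e * μ x) Z ψ ω) :
    |ω| * Z ≤ e ^ 2 * (1 / 2 * (coulombEnergy μ fun _ => ((Real.sqrt Z : ℝ) : ℂ)) + B * Z) := by
  -- Testing the equation with ψ itself expresses ωZ through the Dirichlet and potential terms.
  have hst := h.stationary ψ h.mem.1
  have hD := tsum_freqSq_le_of_isGroundState hμ hZ h
  have hD0 : 0 ≤ ∑' m, freqSq m * ‖mFourierCoeff ψ m‖ ^ 2 :=
    tsum_nonneg fun m => mul_nonneg (freqSq_nonneg m) (sq_nonneg _)
  have hP := abs_integral_potential_mul_norm_sq_le hB h.mem.1.1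
  have hI : ∫ x, e * potential 1 μ ψ x * ‖ψ x‖ ^ 2 ∂torusMeasure
      = e * ∫ x, potential 1 μ ψ x * ‖ψ x‖ ^ 2 ∂torusMeasure := by
    simp only [mul_assoc, integral_const_mul]
  rw [schrodingerForm_self, potential_const_mul, hI, h.mem.2, Complex.ofReal_eq_zero] at hst
  rw [h.mem.2] at hP
  have hω : ω * Z = 1 / 2 * ∑' m, freqSq m * ‖mFourierCoeff ψ m‖ ^ 2
      - e ^ 2 * ∫ x, potential 1 μ ψ x * ‖ψ x‖ ^ 2 ∂torusMeasure := by
    linear_combination -hst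
  have hP1 := mul_le_mul_of_nonneg_left (abs_le.1 hP).1 (sq_nonneg e)
  have hP2 := mul_le_mul_of_nonneg_left (abs_le.1 hP).2 (sq_nonneg e)
  rw [← abs_of_nonneg hZ, ← abs_mul, abs_of_nonneg hZ, hω]
  refine abs_le.2 ⟨?_, ?_⟩ <;> linarith

/-- For small `e` all minimizing ground states have a nonnegative Schrödinger form, a frequency of
order `e²`, and differ from a constant by a term of order `e²` in `H²`. -/
theorem exists_groundState_estimates (hμper : MemLp (periodize μ) 2 torusMeasure) (hZpos : 0 < Z) :
    ∃ e₀ C : ℝ, 0 < e₀ ∧ ∀ e : ℝ, 0 < e → e ≤ e₀ → ∀ (ψ : T3 → ℂ) (ω : ℝ),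
      IsGroundState e (fun x => e * μ x) Z ψ ω →
        (∀ u : T3 → ℂ, MemSobolev 1 u →
          0 ≤ (schrodingerForm e (potential e (fun x => e * μ x) ψ) ω u u).re) ∧
        |ω| ≤ C * e ^ 2 ∧
        ∃ (γ : ℂ) (χ : T3 → ℂ), (∀ x, ψ x = γ + χ x) ∧ |‖γ‖ ^ 2 - Z| ≤ C * e ^ 4 ∧
          MemSobolev 2 χ ∧ sobolevNorm 2 χ ≤ C * e ^ 2 := by
  set K := coulombEnergy μ fun _ => ((Real.sqrt Z : ℝ) : ℂ) with hK
  have hK0 : 0 ≤ K := coulombEnergy_nonneg hμper (memSobolev_const 1 _)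
  set B := potentialBound μ (Z + K) with hBdef
  have hB0 : 0 ≤ B := potentialBound_nonneg _ _
  set C₁ := K / (2 * Z) + B with hC₁
  have hC₁0 : 0 ≤ C₁ := by positivity
  set D := C₁ + B with hD
  have hD0 : 0 ≤ D := by positivity
  -- C₁ controls |ω|/e², and D controls (|ω| + e·eB)/e². The choice of e₀ forces De² ≤ 1/8, enough
  -- both for coercivity (threshold 1/2) and for γ ≠ 0; D + 1 avoids dividing by zero. The three
  -- summands of C serve ω, χ and |γ|² respectively.
  refine ⟨min 1 (1 / (8 * (D + 1))), C₁ + 4 * D * Real.sqrt Z + 16 * D ^ 2 * Z,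
    by positivity, fun e he hle ψ ω h => ?_⟩
  have he1 : e ≤ 1 := hle.trans (min_le_left _ _)
  have he2 : D * e ^ 2 ≤ 1 / 8 := by
    have h1 : e * (8 * (D + 1)) ≤ 1 :=
      (le_div_iff₀ (by positivity)).1 (hle.trans (min_le_right _ _))
    have h2 : D * e ^ 2 ≤ D * e := by
      rw [sq]
      exact mul_le_mul_of_nonneg_left (mul_le_of_le_one_left he.le he1) hD0
    linarith
  have hΦ := continuous_potential hμper h.mem.1
  have hB : ∀ x, |potential 1 μ ψ x| ≤ B :=
    abs_potential_le_of_isGroundState hμper hZpos.le (pow_le_one₀ he.le he1) h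
  have hω : |ω| ≤ C₁ * e ^ 2 := by
    have h1 : |ω| * Z ≤ e ^ 2 * (1 / 2 * K + B * Z) :=
      abs_omega_mul_le_of_isGroundState hμper hZpos.le hB h
    refine le_of_mul_le_mul_right (h1.trans (le_of_eq ?_)) hZpos
    rw [hC₁]
    field_simp
  have hst := h.stationary
  rw [potential_const_mul] at hst ⊢
  have hΦe : Continuous fun x => e * potential 1 μ ψ x := hΦ.const_mul e
  have hBe : ∀ x, |e * potential 1 μ ψ x| ≤ e * B := fun x => by
    rw [abs_mul, abs_of_pos he]
    exact mul_le_mul_of_nonneg_left (hB x) he.le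
  have hsum : |ω| + e * (e * B) ≤ D * e ^ 2 := by
    rw [hD]
    linarith
  obtain ⟨hS, hnorm, hγ⟩ := memSobolev_two_of_stationary he.le hΦe hBe h.mem.1 hst
  rw [h.mem.2] at hnorm hγ
  have hbound : 16 * (|ω| + e * (e * B)) ^ 2 * Z ≤ 16 * (D * e ^ 2) ^ 2 * Z := by gcongr
  have hz := Real.sqrt_nonneg Z
  -- A vanishing mean would give Z ≤ 16·(1/8)²·Z = Z/4.
  have hγ0 : mFourierCoeff ψ 0 ≠ 0 := fun h0 => by
    rw [h0, norm_zero, zero_pow two_ne_zero, zero_sub, abs_neg, abs_of_pos hZpos] at hγ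
    have h1 : 16 * (D * e ^ 2) ^ 2 * Z ≤ 16 * (1 / 8) ^ 2 * Z := by gcongr
    linarith
  refine ⟨fun u hu => schrodingerForm_nonneg_of_stationary he.le hΦe hBe (by linarith) h.mem.1 hγ0
    hst hu, hω.trans ?_, mFourierCoeff ψ 0, _, fun x => ?_, ?_, hS, ?_⟩
  · gcongr
    have : 0 ≤ 4 * D * Real.sqrt Z + 16 * D ^ 2 * Z := by positivity
    linarith
  · ring
  · refine (hγ.trans hbound).trans ?_
    have : 0 ≤ (C₁ + 4 * D * Real.sqrt Z) * e ^ 4 := by positivity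
    linarith
  · have h1 : sobolevNorm 2
        (fun x => ψ x + (-mFourierCoeff ψ 0) * 1) ≤ 4 * D * Real.sqrt Z * e ^ 2 := by
      refine le_of_sq_le_sq ((hnorm.trans hbound).trans (le_of_eq ?_)) (by positivity)
      linear_combination (-16 * D ^ 2 * e ^ 4) * Real.sq_sqrt hZpos.le
    refine h1.trans ?_
    have : 0 ≤ (C₁ + 16 * D ^ 2 * Z) * e ^ 2 := by positivity
    linarith

end GroundState

end SchrodingerPoisson

theorem lemma3p1 (μ : (Fin 3 → ℝ) → ℝ) (Z : ℝ)
    (hμ1 : MeasureTheory.Integrable μ) (hμ2 : MeasureTheory.MemLp μ 2)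
    (hZ : ∫ x, μ x = Z) (hZpos : 0 < Z)
    (hμper : MeasureTheory.MemLp (SchrodingerPoisson.periodize μ) 2
      SchrodingerPoisson.torusMeasure) :
    ∃ e₀ C : ℝ, 0 < e₀ ∧ ∀ e : ℝ, 0 < e → e ≤ e₀ →
      ∀ (ψ : SchrodingerPoisson.T3 → ℂ) (ω : ℝ),
        SchrodingerPoisson.IsGroundState e (fun x => e * μ x) Z ψ ω →
        (∀ u : SchrodingerPoisson.T3 → ℂ, SchrodingerPoisson.MemSobolev 1 u →
          0 ≤ (SchrodingerPoisson.schrodingerForm e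
            (SchrodingerPoisson.potential e (fun x => e * μ x) ψ) ω u u).re) ∧
        |ω| ≤ C * e ^ 2 ∧
        ∃ (γ : ℂ) (χ : SchrodingerPoisson.T3 → ℂ),
          (∀ x, ψ x = γ + χ x) ∧
          |‖γ‖ ^ 2 - Z| ≤ C * e ^ 4 ∧
          SchrodingerPoisson.MemSobolev 2 χ ∧
          SchrodingerPoisson.sobolevNorm 2 χ ≤ C * e ^ 2 :=
  SchrodingerPoisson.exists_groundState_estimates hμper hZpos
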